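/- Let $n\ge 1$. Let $\mathbb R^{2n}=\mathbb C^n$ carry the Euclidean metric, the complex structure $J(x,y)=(-y,x)$ and the Kähler form $\omega(u,v)=\langle u,Jv\rangle$, and let $\eta_p(v)=\langle Jp,v\rangle$ be the standard contact form on the unit sphere $S^{2n-1}$. Let $M$ be an $(n-1)$-dimensional (smoothly immersed) submanifold of $S^{2n-1}$, given by a smooth map $f:M\to S^{2n-1}$ with everywhere injective differential. Let $CM$ be the cone over $M$ with its vertex removed, i.e. the map $M\times(0,\infty)\to\mathbb R^{2n}$, $(x,t)\mapsto t f(x)$. A submanifold is called minimal if its mean curvature vector (the trace of its second fundamental form in the ambient space) vanishes identically. $M$ is called Legendrian if $\eta$ vanishes on all tangent spaces of $M$. An $n$-dimensional linear subspace of $\mathbb R^{2n}$ is called a Lagrangian plane if $\omega$ vanishes on it, and an $n$-dimensional immersed submanifold of $\mathbb R^{2n}$ is called Lagrangian if all its tangent spaces are Lagrangian planes. Let $LG_n$ be the manifold of all (unoriented) Lagrangian planes. 1. $M$ is minimal in $S^{2n-1}$ and Legendrian if and only if $CM$ is a minimal Lagrangian (immersed) submanifold of $\mathbb R^{2n}$.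 2. Whenever $CM$ is Lagrangian (in particular in the situation of 1), the Gauss map $\gamma:CM\to LG_n$, which sends a point of $M\times(0,\infty)$ to the tangent space of $CM$ there, is smooth, and its differential has rank at most $n-1$ at every point. -/

import Mathlib

open scoped Manifold ContDiff InnerProductSpace

noncomputable section

namespace LegendrianCone

/-! ### The ambient space `ℝ²ⁿ = ℂⁿ`, its Kähler form, the contact form of the unit sphere -/

/-- Euclidean space `ℝ²ⁿ`, with points `(x, y) = (x₁, …, xₙ; y₁, …, yₙ)`: the `x`-coordinates are
indexed by the left summand and the `y`-coordinates by the right summand. -/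
abbrev R2n (n : ℕ) : Type := EuclideanSpace ℝ (Fin n ⊕ Fin n)

/-- The standard complex structure `J (x, y) = (-y, x)`. -/
def J {n : ℕ} : R2n n →ₗ[ℝ] R2n n where
  toFun u := WithLp.toLp 2 (Sum.elim (fun i => -u (Sum.inr i)) (fun i => u (Sum.inl i)))
  map_add' u v := by
    ext i; rcases i with i | i <;> simp [add_comm]
  map_smul' c u := by
    ext i; rcases i with i | i <;> simp

/-- The Kähler form `ω(u, v) = ⟨u, J v⟩`. -/
def kahlerForm {n : ℕ} (u v : R2n n) : ℝ := ⟪u, J v⟫_ℝ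

/-- The contact form of the unit sphere: at the point `p`, `η` is dual to the vector `J p`. -/
def contactForm {n : ℕ} (p v : R2n n) : ℝ := ⟪J p, v⟫_ℝ

/-- A Lagrangian plane of `ℝ²ⁿ`: an `n`-dimensional linear subspace on which `ω` vanishes. -/
def IsLagrangianPlane {n : ℕ} (ζ : Submodule ℝ (R2n n)) : Prop :=
  Module.finrank ℝ ζ = n ∧ ∀ u ∈ ζ, ∀ v ∈ ζ, kahlerForm u v = 0

/-- The Lagrangian Grassmannian `LGₙ`, as a set: all Lagrangian planes of `ℝ²ⁿ`. -/
def LagrangianGrassmannian (n : ℕ) : Type :=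
  {ζ : Submodule ℝ (R2n n) // IsLagrangianPlane ζ}

/-- The standard realization of the Grassmannian as a submanifold of the vector space of
endomorphisms of `ℝ²ⁿ`: a plane is sent to the orthogonal projection onto it. It is through this
embedding that `LGₙ` carries its differentiable structure. -/
def LagrangianGrassmannian.toProjection {n : ℕ} (ζ : LagrangianGrassmannian n) :
    R2n n →L[ℝ] R2n n :=
  ζ.1.starProjection

/-! ### Immersed submanifolds and their mean curvature

A submanifold is given by an immersion `F` of an abstract manifold `N` (without boundary, modelled
on a finite-dimensional space `E`) into a Euclidean space `V`. -/

section Submanifolds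

variable {E : Type*} [NormedAddCommGroup E] [NormedSpace ℝ E]
  {H : Type*} [TopologicalSpace H] (I : ModelWithCorners ℝ E H)
  {N : Type*} [TopologicalSpace N] [ChartedSpace H N]
  {V : Type*} [NormedAddCommGroup V] [InnerProductSpace ℝ V]

/-- Smooth immersions: `C^∞` maps whose differential is injective at every point. -/
def IsSmoothImmersion (F : N → V) : Prop :=
  ContMDiff I 𝓘(ℝ, V) ∞ F ∧ ∀ p : N, Function.Injective (mfderiv I 𝓘(ℝ, V) F p)

/-- The tangent plane `dF(T_p N)` of the immersed submanifold, translated to the origin of `V`. -/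
def tangentPlane (F : N → V) (p : N) : Submodule ℝ V :=
  LinearMap.range (mfderiv I 𝓘(ℝ, V) F p : E →L[ℝ] V).toLinearMap

/-- First derivative `∂_v F` at `p`, in the preferred chart of `N` at `p`. -/
def chartDeriv (F : N → V) (p : N) (v : E) : V :=
  fderiv ℝ (F ∘ (extChartAt I p).symm) (extChartAt I p p) v

/-- Second derivative `∂_v ∂_w F` at `p`, in the preferred chart of `N` at `p`. -/
def chartDeriv₂ (F : N → V) (p : N) (v w : E) : V :=
  fderiv ℝ (fderiv ℝ (F ∘ (extChartAt I p).symm)) (extChartAt I p p) v w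

/-- The second fundamental form at `p` of the immersion `F` into an ambient submanifold of `V` whose
tangent space at `F p` is `W` (`W = ⊤` when the ambient manifold is `V` itself, `W = (F p)^⊥` when
it is the unit sphere): the component of `∂_v ∂_w F` in the normal space, which is the orthogonal
complement of `dF(T_p N)` in `W`. -/
def secondFundamentalForm [FiniteDimensional ℝ V] (W : Submodule ℝ V) (F : N → V) (p : N)
    (v w : E) : V :=
  (W ⊓ (tangentPlane I F p)ᗮ).starProjection (chartDeriv₂ I F p v w)

/-- The first fundamental form (induced metric) `g_ij = ⟨∂_i F, ∂_j F⟩` at `p`, with respect to a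
basis of `E`. -/
def firstFundamentalForm {ι : Type*} (b : Module.Basis ι ℝ E) (F : N → V) (p : N) :
    Matrix ι ι ℝ :=
  Matrix.of fun i j => ⟪chartDeriv I F p (b i), chartDeriv I F p (b j)⟫_ℝ

/-- The (unnormalized) mean curvature vector `∑ g^{ij} B(∂_i, ∂_j)`, the trace of the second
fundamental form with respect to the induced metric. -/
def meanCurvature [FiniteDimensional ℝ E] [FiniteDimensional ℝ V] (W : Submodule ℝ V) (F : N → V)
    (p : N) : V :=
  let b := Module.finBasis ℝ E
  ∑ i, ∑ j, (firstFundamentalForm I b F p)⁻¹ i j • secondFundamentalForm I W F p (b i) (b j)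

/-- The immersed submanifold `F` is minimal in `V`. -/
def IsMinimal [FiniteDimensional ℝ E] [FiniteDimensional ℝ V] (F : N → V) : Prop :=
  ∀ p, meanCurvature I ⊤ F p = 0

/-- The immersed submanifold `f` of the unit sphere of `V` is minimal in the sphere, whose
tangent space at `f p` is the orthogonal complement of `f p`. -/
def IsMinimalInSphere [FiniteDimensional ℝ E] [FiniteDimensional ℝ V]
    (f : N → Metric.sphere (0 : V) 1) : Prop :=
  ∀ p, meanCurvature I (ℝ ∙ (f p : V))ᗮ (fun q => (f q : V)) p = 0

/-- `f` is an integral submanifold of the distribution `η = 0` on the unit sphere of `ℝ²ⁿ`; it is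
Legendrian when its dimension is `n - 1`. -/
def IsLegendrian {n : ℕ} (f : N → Metric.sphere (0 : R2n n) 1) : Prop :=
  Module.finrank ℝ E = n - 1 ∧
    ∀ p, ∀ v ∈ tangentPlane I (fun q => (f q : R2n n)) p, contactForm (f p : R2n n) v = 0

/-- All tangent planes of the submanifold `F` of `ℝ²ⁿ` are Lagrangian planes. -/
def IsLagrangian {n : ℕ} (F : N → R2n n) : Prop :=
  ∀ p, IsLagrangianPlane (tangentPlane I F p)

/-- `F` is a minimal Lagrangian (immersed) submanifold of `ℝ²ⁿ`. -/
def IsMinimalLagrangianSubmanifold [FiniteDimensional ℝ E] {n : ℕ} (F : N → R2n n) : Prop :=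
  IsSmoothImmersion I F ∧ IsMinimal I F ∧ IsLagrangian I F

/-- The Gauss map `γ(p) = T_p N ∈ LGₙ` of a Lagrangian submanifold of `ℝ²ⁿ`. -/
def gaussMap {n : ℕ} {F : N → R2n n} (hF : IsLagrangian I F) (p : N) : LagrangianGrassmannian n :=
  ⟨tangentPlane I F p, hF p⟩

/-- Smoothness of a map into `LGₙ`. -/
def SmoothIntoLG {n : ℕ} (γ : N → LagrangianGrassmannian n) : Prop :=
  ContMDiff I 𝓘(ℝ, R2n n →L[ℝ] R2n n) ∞ fun p => (γ p).toProjection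

/-- The rank at `p` of (the differential of) a smooth map into `LGₙ`. -/
def rankIntoLG {n : ℕ} (γ : N → LagrangianGrassmannian n) (p : N) : ℕ :=
  Module.finrank ℝ (LinearMap.range
    (mfderiv I 𝓘(ℝ, R2n n →L[ℝ] R2n n) (fun q => (γ q).toProjection) p :
      E →L[ℝ] (R2n n →L[ℝ] R2n n)).toLinearMap)

end Submanifolds

/-! ### The cone -/

/-- The open half-line `(0, ∞)`, a one-dimensional manifold. -/
abbrev PosReal : TopologicalSpace.Opens ℝ := ⟨Set.Ioi 0, isOpen_Ioi⟩

/-- The cone (without its vertex) over `f : M → S^{2n-1}`: the map `(x, t) ↦ t x` on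
`M × (0, ∞)`. -/
def cone {n : ℕ} {M : Type*} (f : M → Metric.sphere (0 : R2n n) 1) (q : M × PosReal) : R2n n :=
  (q.2 : ℝ) • (f q.1 : R2n n)

end LegendrianCone

end

/-!
In a chart of `M` the immersion `f` is a map `u` with values in the unit sphere, and the cone is
`(e, s) ↦ s • u e`. Since `⟪u, ∂_v u⟫ = 0`, the tangent plane of the cone at `t f(x)` is the
orthogonal sum `ℝ f(x) ⊕ T_x M` (`tangentPlane_cone`), whatever `t` is.

*Minimality.* Consequently the normal space of the cone in `ℝ²ⁿ` is the normal space of `M` in the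
sphere (`normalSpace_cone`). The second derivatives of `s • u e` that involve `s` are tangential, so
the second fundamental form of the cone at height `t` is `t` times that of `M`, with the radial
direction in its kernel (`secondFundamentalForm_cone`). The induced metric is the block matrix
`diag (t² g, 1)` (`firstFundamentalForm_cone`). Tracing in a basis adapted to `E × ℝ`, which the
basis independence `sum_inv_toMatrix_smul_eq` allows, gives `H_cone = t⁻¹ H_M`
(`meanCurvature_cone`).

*Lagrangian versus Legendrian.* The Kähler form on `ℝ f(x) ⊕ T_x M` consists of the pairing of
`f(x)` with `T_x M`, which is `-η`, and of its restriction to `T_x M`. The latter vanishes as soon as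
`η` does, by differentiating `η = 0` and using the symmetry of second derivatives
(`kahlerForm_fderiv_eq_zero`).

*The Gauss map.* It is `(x, t) ↦ ℝ f(x) ⊕ T_x M`, so it factors through the projection
`M × (0, ∞) → M` (`toProjection_gaussMap_cone`), whence the bound on the rank. It is smooth because
the orthogonal projection onto the range of an injective `D` is `D (D* D)⁻¹ D*`
(`starProjection_range_eq`).
-/

open scoped Topology

namespace LegendrianCone

/-! ### The trace of a bilinear map with respect to an inner product -/

section Trace

variable {E V : Type*} [AddCommGroup E] [Module ℝ E] [AddCommGroup V] [Module ℝ V]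

/-- The trace `∑ gⁱʲ B(bᵢ, bⱼ)` of a vector-valued bilinear map `B` with respect to a nondegenerate
bilinear form `g` does not depend on the basis: if `P` is the change of basis, then `g` becomes
`Pᵀ g P`, so `P g⁻¹ Pᵀ`, computed in the new basis, is the old `g⁻¹`. -/
lemma sum_inv_toMatrix_smul_eq {ι κ : Type*} [Fintype ι] [DecidableEq ι] [Fintype κ]
    [DecidableEq κ] (b : Module.Basis ι ℝ E) (c : Module.Basis κ ℝ E)
    (g : LinearMap.BilinForm ℝ E) (hg : IsUnit (LinearMap.BilinForm.toMatrix b g).det)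
    (B : E →ₗ[ℝ] E →ₗ[ℝ] V) :
    ∑ k, ∑ l, (LinearMap.BilinForm.toMatrix c g)⁻¹ k l • B (c k) (c l) =
      ∑ i, ∑ j, (LinearMap.BilinForm.toMatrix b g)⁻¹ i j • B (b i) (b j) := by
  set G := LinearMap.BilinForm.toMatrix b g
  set P := b.toMatrix c
  set Q := c.toMatrix b
  have hPQ : P * Q = 1 := b.toMatrix_mul_toMatrix_flip c
  have hQP : Q * P = 1 := c.toMatrix_mul_toMatrix_flip b
  have hGG : G * G⁻¹ = 1 := Matrix.mul_nonsing_inv _ hg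
  have hG' : LinearMap.BilinForm.toMatrix c g = P.transpose * G * P :=
    (LinearMap.BilinForm.toMatrix_mul_basis_toMatrix b c g).symm
  have hinv : (LinearMap.BilinForm.toMatrix c g)⁻¹ = Q * G⁻¹ * Q.transpose := by
    refine Matrix.inv_eq_right_inv ?_
    calc LinearMap.BilinForm.toMatrix c g * (Q * G⁻¹ * Q.transpose)
        = P.transpose * (G * ((P * Q) * G⁻¹)) * Q.transpose := by
          rw [hG']; simp only [Matrix.mul_assoc]
      _ = (Q * P).transpose := by
          rw [hPQ, Matrix.one_mul, hGG, Matrix.mul_one, Matrix.transpose_mul]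
      _ = 1 := by rw [hQP, Matrix.transpose_one]
  have hmid : P * (LinearMap.BilinForm.toMatrix c g)⁻¹ * P.transpose = G⁻¹ := by
    calc P * (LinearMap.BilinForm.toMatrix c g)⁻¹ * P.transpose
        = (P * Q) * G⁻¹ * (P * Q).transpose := by
          rw [hinv, Matrix.transpose_mul]; simp only [Matrix.mul_assoc]
      _ = G⁻¹ := by rw [hPQ, Matrix.one_mul, Matrix.transpose_one, Matrix.mul_one]
  have hB : ∀ k l, B (c k) (c l) = ∑ i, ∑ j, (P i k * P j l) • B (b i) (b j) := by
    intro k l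
    conv_lhs => rw [← b.sum_toMatrix_smul_self c k, ← b.sum_toMatrix_smul_self c l]
    simp only [map_sum, map_smul, LinearMap.sum_apply, LinearMap.smul_apply, Finset.smul_sum,
      smul_smul]
    rw [Finset.sum_comm]
    simp only [P, mul_comm]
  have hent : ∀ i j, G⁻¹ i j =
      ∑ k, ∑ l, (LinearMap.BilinForm.toMatrix c g)⁻¹ k l * (P i k * P j l) := by
    intro i j
    rw [← hmid, Matrix.mul_apply, Finset.sum_comm]
    refine Finset.sum_congr rfl fun l _ => ?_
    rw [Matrix.mul_apply, Finset.sum_mul]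
    refine Finset.sum_congr rfl fun k _ => ?_
    rw [Matrix.transpose_apply]; ring
  simp only [hB, hent, Finset.smul_sum, Finset.sum_smul, smul_smul]
  calc _ = ∑ k, ∑ i, ∑ l, ∑ j, ((LinearMap.BilinForm.toMatrix c g)⁻¹ k l * (P i k * P j l)) •
        B (b i) (b j) := Finset.sum_congr rfl fun k _ => Finset.sum_comm
    _ = ∑ i, ∑ k, ∑ j, ∑ l, ((LinearMap.BilinForm.toMatrix c g)⁻¹ k l * (P i k * P j l)) •
        B (b i) (b j) := by
      rw [Finset.sum_comm]
      exact Finset.sum_congr rfl fun i _ => Finset.sum_congr rfl fun k _ => Finset.sum_comm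
    _ = _ := Finset.sum_congr rfl fun i _ => Finset.sum_comm

end Trace

/-! ### Immersed submanifolds in charts -/

section Chart

variable {E : Type*} [NormedAddCommGroup E] [NormedSpace ℝ E]
  {H : Type*} [TopologicalSpace H] {I : ModelWithCorners ℝ E H}
  {N : Type*} [TopologicalSpace N] [ChartedSpace H N]
  {V : Type*} [NormedAddCommGroup V] [InnerProductSpace ℝ V]

/-- The trace of the second fundamental form may be computed in any basis of the model space. -/
lemma meanCurvature_eq_sum [FiniteDimensional ℝ E] [FiniteDimensional ℝ V]
    {ι : Type*} [Fintype ι] [DecidableEq ι] (b : Module.Basis ι ℝ E)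
    (W : Submodule ℝ V) {F : N → V} {p : N} (hinj : Function.Injective (chartDeriv I F p)) :
    meanCurvature I W F p = ∑ i, ∑ j,
      (firstFundamentalForm I b F p)⁻¹ i j • secondFundamentalForm I W F p (b i) (b j) := by
  let D : E →ₗ[ℝ] V := (fderiv ℝ (F ∘ (extChartAt I p).symm) (extChartAt I p p)).toLinearMap
  let g : LinearMap.BilinForm ℝ E := (innerₗ V).compl₁₂ D D
  let B : E →ₗ[ℝ] E →ₗ[ℝ] V := LinearMap.mk₂ ℝ (secondFundamentalForm I W F p)
    (by intros; simp [secondFundamentalForm, chartDeriv₂])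
    (by intros; simp [secondFundamentalForm, chartDeriv₂])
    (by intros; simp [secondFundamentalForm, chartDeriv₂])
    (by intros; simp [secondFundamentalForm, chartDeriv₂])
  have hG : LinearMap.BilinForm.toMatrix b g = firstFundamentalForm I b F p := by
    ext i j
    rw [LinearMap.BilinForm.toMatrix_apply]
    rfl
  have hg : IsUnit (LinearMap.BilinForm.toMatrix b g).det := by
    rw [isUnit_iff_ne_zero, hG]
    have hli : LinearIndependent ℝ (fun i => D (b i)) :=
      b.linearIndependent.map' D (LinearMap.ker_eq_bot.2 hinj)
    exact (Matrix.det_gram_ne_zero_iff_linearIndependent (𝕜 := ℝ)).2 hli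
  have hG' : LinearMap.BilinForm.toMatrix (Module.finBasis ℝ E) g =
      firstFundamentalForm I (Module.finBasis ℝ E) F p := by
    ext i j
    rw [LinearMap.BilinForm.toMatrix_apply]
    rfl
  have h := sum_inv_toMatrix_smul_eq b (Module.finBasis ℝ E) g hg B
  rw [hG, hG'] at h
  exact h

variable [I.Boundaryless]

lemma mfderiv_eq_fderiv_chart {F : N → V} {p : N} (hF : MDifferentiableAt I 𝓘(ℝ, V) F p) :
    mfderiv I 𝓘(ℝ, V) F p =
      fderiv ℝ (F ∘ (extChartAt I p).symm) (extChartAt I p p) := by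
  rw [hF.mfderiv]
  simp only [writtenInExtChartAt, extChartAt_model_space_eq_id, PartialEquiv.refl_coe,
    Function.id_comp, I.range_eq_univ, fderivWithin_univ]
  rfl

lemma tangentPlane_eq_range {F : N → V} {p : N} (hF : MDifferentiableAt I 𝓘(ℝ, V) F p) :
    tangentPlane I F p =
      (fderiv ℝ (F ∘ (extChartAt I p).symm) (extChartAt I p p)).range := by
  unfold tangentPlane
  rw [mfderiv_eq_fderiv_chart hF]
  rfl

lemma mem_tangentPlane_iff {F : N → V} {p : N} (hF : MDifferentiableAt I 𝓘(ℝ, V) F p) {v : V} :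
    v ∈ tangentPlane I F p ↔ ∃ w, chartDeriv I F p w = v := by
  rw [tangentPlane_eq_range hF]
  rfl

/-- The coordinate representation of a smooth map is smooth on the whole target of the chart. -/
lemma contDiffAt_comp_extChartAt_symm [IsManifold I ∞ N] {F : N → V}
    (hF : ContMDiff I 𝓘(ℝ, V) ∞ F) (p : N) {e : E} (he : e ∈ (extChartAt I p).target) :
    ContDiffAt ℝ ∞ (F ∘ (extChartAt I p).symm) e := by
  rw [← contMDiffAt_iff_contDiffAt]
  refine hF.contMDiffAt.comp e ?_
  exact (contMDiffOn_extChartAt_symm p).contMDiffAt (extChartAt_target_mem_nhds' he)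

/-- The tangent plane can be read off in any chart around the point. -/
lemma tangentPlane_eq_range_of_mem_source [IsManifold I ∞ N] {F : N → V}
    (hF : ContMDiff I 𝓘(ℝ, V) ∞ F) {p q : N} (hq : q ∈ (extChartAt I p).source) :
    tangentPlane I F q =
      (fderiv ℝ (F ∘ (extChartAt I p).symm) (extChartAt I p q)).range := by
  have he : extChartAt I p q ∈ (extChartAt I p).target := (extChartAt I p).map_source hq
  have hFq : MDifferentiableAt I 𝓘(ℝ, V) F q := hF.mdifferentiableAt (by simp)
  have hu := (contDiffAt_comp_extChartAt_symm hF p he).differentiableAt (by simp)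
  have h1 : MDifferentiableAt I 𝓘(ℝ, E) (extChartAt I p) q :=
    (contMDiffAt_extChartAt' (n := ∞) (by simpa using hq)).mdifferentiableAt (by simp)
  have h2 : MDifferentiableAt 𝓘(ℝ, E) I (extChartAt I p).symm (extChartAt I p q) :=
    ((contMDiffOn_extChartAt_symm (n := ∞) p).contMDiffAt
      (extChartAt_target_mem_nhds' he)).mdifferentiableAt (by simp)
  unfold tangentPlane
  apply le_antisymm
  · have hEq : F =ᶠ[𝓝 q] (F ∘ (extChartAt I p).symm) ∘ extChartAt I p := by
      filter_upwards [extChartAt_source_mem_nhds' (I := I) hq] with y hy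
      rw [Function.comp_apply, Function.comp_apply, (extChartAt I p).left_inv hy]
    rintro _ ⟨v, rfl⟩
    refine ⟨mfderiv I 𝓘(ℝ, E) (extChartAt I p) q v, ?_⟩
    have := mfderiv_comp q hu.mdifferentiableAt h1
    rw [← hEq.mfderiv_eq, mfderiv_eq_fderiv] at this
    exact (DFunLike.congr_fun this v).symm
  · rintro _ ⟨v, rfl⟩
    refine ⟨mfderiv 𝓘(ℝ, E) I (extChartAt I p).symm (extChartAt I p q) v, ?_⟩
    have hq' : (extChartAt I p).symm (extChartAt I p q) = q := (extChartAt I p).left_inv hq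
    have := mfderiv_comp (extChartAt I p q) (g := F) (by rw [hq']; exact hFq) h2
    rw [mfderiv_eq_fderiv, hq'] at this
    exact (DFunLike.congr_fun this v).symm

end Chart

/-! ### Derivatives of `(e, s) ↦ s • u e` -/

section SmulSnd

variable {E : Type*} [NormedAddCommGroup E] [NormedSpace ℝ E]
  {V : Type*} [NormedAddCommGroup V] [NormedSpace ℝ V]

lemma fderiv_snd_smul {u : E → V} {z : E × ℝ} (hu : DifferentiableAt ℝ u z.1) (w : E × ℝ) :
    fderiv ℝ (fun z : E × ℝ => z.2 • u z.1) z w = w.2 • u z.1 + z.2 • fderiv ℝ u z.1 w.1 := by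
  have h1 : HasFDerivAt (fun z : E × ℝ => u z.1)
      ((fderiv ℝ u z.1).comp (ContinuousLinearMap.fst ℝ E ℝ)) z :=
    hu.hasFDerivAt.comp z hasFDerivAt_fst
  have h2 : HasFDerivAt (fun z : E × ℝ => z.2) (ContinuousLinearMap.snd ℝ E ℝ) z :=
    hasFDerivAt_snd
  have h3 : HasFDerivAt (fun z : E × ℝ => z.2 • u z.1) _ z := h2.smul h1
  rw [h3.fderiv]
  simp [add_comm]

lemma fderiv_fderiv_snd_smul {u : E → V} {z : E × ℝ} (hu : ContDiffAt ℝ ∞ u z.1)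
    (v w : E × ℝ) :
    fderiv ℝ (fderiv ℝ (fun z : E × ℝ => z.2 • u z.1)) z v w =
      w.2 • fderiv ℝ u z.1 v.1 +
        (v.2 • fderiv ℝ u z.1 w.1 + z.2 • fderiv ℝ (fderiv ℝ u) z.1 v.1 w.1) := by
  have hdu : DifferentiableAt ℝ (fderiv ℝ u) z.1 :=
    (hu.fderiv_right (m := ∞) (by simp)).differentiableAt (by simp)
  have hG : ContDiffAt ℝ ∞ (fun z : E × ℝ => z.2 • u z.1) z :=
    contDiffAt_snd.smul (hu.comp z contDiffAt_fst)
  have hdG : DifferentiableAt ℝ (fderiv ℝ (fun z : E × ℝ => z.2 • u z.1)) z :=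
    (hG.fderiv_right (m := ∞) (by simp)).differentiableAt (by simp)
  have hev : (fun y => fderiv ℝ (fun z : E × ℝ => z.2 • u z.1) y w) =ᶠ[𝓝 z]
      fun y => w.2 • u y.1 + y.2 • fderiv ℝ u y.1 w.1 := by
    have : ∀ᶠ e in 𝓝 z.1, ContDiffAt ℝ 1 u e :=
      (hu.of_le (by exact_mod_cast le_top)).eventually (by simp)
    filter_upwards [continuous_fst.continuousAt.eventually this] with y hy
    exact fderiv_snd_smul (hy.differentiableAt (by simp)) w
  have h1 : HasFDerivAt (fun z : E × ℝ => u z.1)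
      ((fderiv ℝ u z.1).comp (ContinuousLinearMap.fst ℝ E ℝ)) z :=
    (hu.differentiableAt (by simp)).hasFDerivAt.comp z hasFDerivAt_fst
  have h2 : DifferentiableAt ℝ (fun e => fderiv ℝ u e w.1) z.1 :=
    hdu.clm_apply (differentiableAt_const _)
  have hl : fderiv ℝ (fderiv ℝ (fun z : E × ℝ => z.2 • u z.1)) z v w =
      fderiv ℝ (fun y => fderiv ℝ (fun z : E × ℝ => z.2 • u z.1) y w) z v := by
    rw [fderiv_clm_apply hdG (differentiableAt_const _)]
    simp
  have h3 : DifferentiableAt ℝ (fun y : E × ℝ => y.2 • fderiv ℝ u y.1 w.1) z :=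
    differentiableAt_snd.smul (h2.comp z differentiableAt_fst)
  have h4 : fderiv ℝ (fun e => fderiv ℝ u e w.1) z.1 v.1 =
      fderiv ℝ (fderiv ℝ u) z.1 v.1 w.1 := by
    rw [fderiv_clm_apply hdu (differentiableAt_const _)]
    simp
  rw [hl, hev.fderiv_eq, fderiv_fun_add (h1.differentiableAt.fun_const_smul _) h3,
    add_apply, fderiv_fun_const_smul h1.differentiableAt, h1.fderiv,
    fderiv_snd_smul (u := fun e => fderiv ℝ u e w.1) h2, h4]
  simp

end SmulSnd

lemma inner_fderiv_eq_zero_of_norm_eq_one {E V : Type*} [NormedAddCommGroup E] [NormedSpace ℝ E]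
    [NormedAddCommGroup V] [InnerProductSpace ℝ V] {u : E → V} {e : E}
    (hu : DifferentiableAt ℝ u e) (h1 : ∀ y, ‖u y‖ = 1) (v : E) :
    ⟪u e, fderiv ℝ u e v⟫_ℝ = 0 := by
  have hone : (fun y => ⟪u y, u y⟫_ℝ) = fun _ => (1 : ℝ) := by
    funext y
    simp [h1]
  have h := fderiv_inner_apply ℝ hu hu v
  rw [hone, fderiv_fun_const, real_inner_comm (u _) (fderiv ℝ u _ v)] at h
  simp only [Pi.zero_apply, zero_apply] at h
  linarith

/-! ### The cone in charts: tangent planes, fundamental forms, mean curvature -/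

section ConeChart

variable {n : ℕ} {E : Type*} [NormedAddCommGroup E] [NormedSpace ℝ E]
  {H : Type*} [TopologicalSpace H] {I : ModelWithCorners ℝ E H} [I.Boundaryless]
  {M : Type*} [TopologicalSpace M] [ChartedSpace H M]
  {f : M → Metric.sphere (0 : R2n n) 1}

omit [I.Boundaryless] in
lemma extChartAt_prod_posReal (x : M) (t : PosReal) :
    extChartAt (I.prod 𝓘(ℝ, ℝ)) (x, t) (x, t) = (extChartAt I x x, (t : ℝ)) := rfl

omit [I.Boundaryless] in
lemma cone_comp_extChartAt_symm (x : M) (t : PosReal) :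
    cone f ∘ (extChartAt (I.prod 𝓘(ℝ, ℝ)) (x, t)).symm
      =ᶠ[𝓝 (extChartAt (I.prod 𝓘(ℝ, ℝ)) (x, t) (x, t))]
      fun z => z.2 • ((fun y => (f y : R2n n)) ∘ (extChartAt I x).symm) z.1 := by
  have h : ∀ᶠ s in 𝓝 (t : ℝ), s = ((chartAt ℝ t).symm s : ℝ) :=
    TopologicalSpace.Opens.chartAt_subtype_val_symm_eventuallyEq PosReal
  have h' : ∀ᶠ z : E × ℝ in 𝓝 (extChartAt (I.prod 𝓘(ℝ, ℝ)) (x, t) (x, t)),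
      z.2 = ((chartAt ℝ t).symm z.2 : ℝ) := by
    rw [extChartAt_prod_posReal]
    exact (continuous_snd.tendsto (extChartAt I x x, (t : ℝ))).eventually h
  filter_upwards [h'] with z hz
  rw [hz]
  rfl

lemma chartDeriv_cone [IsManifold I ∞ M]
    (hf : ContMDiff I 𝓘(ℝ, R2n n) ∞ (fun x => (f x : R2n n))) (x : M) (t : PosReal)
    (w : E × ℝ) :
    chartDeriv (I.prod 𝓘(ℝ, ℝ)) (cone f) (x, t) w =
      w.2 • (f x : R2n n) + (t : ℝ) • chartDeriv I (fun y => (f y : R2n n)) x w.1 := by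
  have hu := contDiffAt_comp_extChartAt_symm hf x (mem_extChartAt_target (I := I) x)
  unfold chartDeriv
  rw [(cone_comp_extChartAt_symm x t).fderiv_eq, fderiv_snd_smul]
  · simp only [extChartAt_prod_posReal, Function.comp_apply, extChartAt_to_inv]
  · exact hu.differentiableAt (by simp)

lemma chartDeriv₂_cone [IsManifold I ∞ M]
    (hf : ContMDiff I 𝓘(ℝ, R2n n) ∞ (fun x => (f x : R2n n))) (x : M) (t : PosReal)
    (v w : E × ℝ) :
    chartDeriv₂ (I.prod 𝓘(ℝ, ℝ)) (cone f) (x, t) v w =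
      w.2 • chartDeriv I (fun y => (f y : R2n n)) x v.1 +
        (v.2 • chartDeriv I (fun y => (f y : R2n n)) x w.1 +
          (t : ℝ) • chartDeriv₂ I (fun y => (f y : R2n n)) x v.1 w.1) := by
  have hu := contDiffAt_comp_extChartAt_symm hf x (mem_extChartAt_target (I := I) x)
  unfold chartDeriv₂ chartDeriv
  rw [(cone_comp_extChartAt_symm x t).fderiv.fderiv_eq, fderiv_fderiv_snd_smul hu]
  rfl

lemma inner_chartDeriv_eq_zero [IsManifold I ∞ M]
    (hf : ContMDiff I 𝓘(ℝ, R2n n) ∞ (fun x => (f x : R2n n))) (x : M) (v : E) :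
    ⟪(f x : R2n n), chartDeriv I (fun y => (f y : R2n n)) x v⟫_ℝ = 0 := by
  have hu := (contDiffAt_comp_extChartAt_symm hf x
    (mem_extChartAt_target (I := I) x)).differentiableAt (by simp)
  have h := inner_fderiv_eq_zero_of_norm_eq_one hu (fun e => by simp) v
  rwa [Function.comp_apply, extChartAt_to_inv] at h

omit [I.Boundaryless] in
lemma contMDiff_cone (hf : ContMDiff I 𝓘(ℝ, R2n n) ∞ (fun x => (f x : R2n n))) :
    ContMDiff (I.prod 𝓘(ℝ, ℝ)) 𝓘(ℝ, R2n n) ∞ (cone f) :=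
  (contMDiff_subtype_val.comp contMDiff_snd).smul (hf.comp contMDiff_fst)

variable [IsManifold I ∞ M]

omit [IsManifold I ∞ M] in
lemma IsSmoothImmersion.chartDeriv_injective {V : Type*} [NormedAddCommGroup V]
    [InnerProductSpace ℝ V] {F : M → V} (hF : IsSmoothImmersion I F) (x : M) :
    Function.Injective (chartDeriv I F x) := by
  have h := hF.2 x
  rw [mfderiv_eq_fderiv_chart (hF.1.mdifferentiableAt (by simp))] at h
  exact h

lemma isSmoothImmersion_cone (hf : IsSmoothImmersion I (fun x => (f x : R2n n))) :
    IsSmoothImmersion (I.prod 𝓘(ℝ, ℝ)) (cone f) := by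
  refine ⟨contMDiff_cone hf.1, fun ⟨x, t⟩ => ?_⟩
  rw [mfderiv_eq_fderiv_chart ((contMDiff_cone hf.1).mdifferentiableAt (by simp))]
  have ht : (t : ℝ) ≠ 0 := ne_of_gt t.2
  refine (injective_iff_map_eq_zero (fderiv ℝ (cone f ∘
    (extChartAt (I.prod 𝓘(ℝ, ℝ)) (x, t)).symm) _)).2 fun w hw => ?_
  have hw' : chartDeriv (I.prod 𝓘(ℝ, ℝ)) (cone f) (x, t) w = 0 := hw
  rw [chartDeriv_cone hf.1] at hw'
  -- Pairing with the radial direction isolates the radial coefficient.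
  have h2 : w.2 = 0 := by
    have := congrArg (fun y => ⟪(f x : R2n n), y⟫_ℝ) hw'
    simpa [inner_add_right, real_inner_smul_right, inner_chartDeriv_eq_zero hf.1] using this
  rw [h2, zero_smul, zero_add, smul_eq_zero] at hw'
  have h1 : w.1 = 0 := hf.chartDeriv_injective x
    ((hw'.resolve_left ht).trans (map_zero (fderiv ℝ _ _)).symm)
  exact Prod.ext h1 h2

lemma tangentPlane_cone (hf : ContMDiff I 𝓘(ℝ, R2n n) ∞ (fun x => (f x : R2n n)))
    (x : M) (t : PosReal) :
    tangentPlane (I.prod 𝓘(ℝ, ℝ)) (cone f) (x, t) =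
      (ℝ ∙ (f x : R2n n)) ⊔ tangentPlane I (fun y => (f y : R2n n)) x := by
  have ht : (t : ℝ) ≠ 0 := ne_of_gt t.2
  ext v
  rw [mem_tangentPlane_iff ((contMDiff_cone hf).mdifferentiableAt (by simp)), Submodule.mem_sup]
  simp only [mem_tangentPlane_iff (hf.mdifferentiableAt (x := x) (by simp)),
    Submodule.mem_span_singleton, chartDeriv_cone hf]
  constructor
  · rintro ⟨w, rfl⟩
    exact ⟨_, ⟨w.2, rfl⟩, _, ⟨(t : ℝ) • w.1, map_smul (fderiv ℝ _ _) _ _⟩, rfl⟩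
  · rintro ⟨_, ⟨a, rfl⟩, _, ⟨w, rfl⟩, rfl⟩
    refine ⟨((t : ℝ)⁻¹ • w, a), ?_⟩
    have : chartDeriv I (fun y => (f y : R2n n)) x ((t : ℝ)⁻¹ • w) =
        (t : ℝ)⁻¹ • chartDeriv I (fun y => (f y : R2n n)) x w := map_smul (fderiv ℝ _ _) _ _
    rw [this, smul_inv_smul₀ ht]

/-- The cone and its link have the same normal spaces, the former taken in `ℝ²ⁿ` and the latter in
the sphere. -/
lemma normalSpace_cone (hf : ContMDiff I 𝓘(ℝ, R2n n) ∞ (fun x => (f x : R2n n)))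
    (x : M) (t : PosReal) :
    ⊤ ⊓ (tangentPlane (I.prod 𝓘(ℝ, ℝ)) (cone f) (x, t))ᗮ =
      (ℝ ∙ (f x : R2n n))ᗮ ⊓ (tangentPlane I (fun y => (f y : R2n n)) x)ᗮ := by
  rw [top_inf_eq, tangentPlane_cone hf, Submodule.inf_orthogonal]

lemma secondFundamentalForm_cone (hf : ContMDiff I 𝓘(ℝ, R2n n) ∞ (fun x => (f x : R2n n)))
    (x : M) (t : PosReal) (v w : E × ℝ) :
    secondFundamentalForm (I.prod 𝓘(ℝ, ℝ)) ⊤ (cone f) (x, t) v w =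
      (t : ℝ) • secondFundamentalForm I (ℝ ∙ (f x : R2n n))ᗮ (fun y => (f y : R2n n)) x
        v.1 w.1 := by
  -- The mixed second derivatives `∂_v ∂_s` are tangential, so they do not contribute.
  have h0 : ∀ y : E, ((ℝ ∙ (f x : R2n n))ᗮ ⊓
      (tangentPlane I (fun y => (f y : R2n n)) x)ᗮ).starProjection
        (chartDeriv I (fun y => (f y : R2n n)) x y) = 0 := by
    intro y
    rw [Submodule.starProjection_apply_eq_zero_iff, Submodule.mem_orthogonal]
    intro z hz
    rw [real_inner_comm]
    exact hz.2 _ ((mem_tangentPlane_iff (hf.mdifferentiableAt (by simp))).2 ⟨y, rfl⟩)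
  unfold secondFundamentalForm
  simp only [normalSpace_cone hf, chartDeriv₂_cone hf, map_add, map_smul, h0, smul_zero, zero_add]

lemma firstFundamentalForm_cone (hf : ContMDiff I 𝓘(ℝ, R2n n) ∞ (fun x => (f x : R2n n)))
    (x : M) (t : PosReal) {ι : Type*} (b : Module.Basis ι ℝ E) :
    firstFundamentalForm (I.prod 𝓘(ℝ, ℝ)) (b.prod (Module.Basis.singleton Unit ℝ)) (cone f)
        (x, t) =
      Matrix.fromBlocks ((t : ℝ) ^ 2 • firstFundamentalForm I b (fun y => (f y : R2n n)) x)
        0 0 1 := by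
  have h0 : chartDeriv I (fun y => (f y : R2n n)) x 0 = 0 := map_zero (fderiv ℝ _ _)
  have h1 := inner_chartDeriv_eq_zero hf x
  have h2 := fun v => (real_inner_comm _ _).trans (h1 v)
  ext (i | i) (j | j) <;>
    simp [firstFundamentalForm, chartDeriv_cone hf, h0, h1, h2, real_inner_smul_left,
      real_inner_smul_right, sq, mul_assoc]

/-- The mean curvature vector of the cone at `t p` is `1 / t` times that of the link at `p`. -/
lemma meanCurvature_cone [FiniteDimensional ℝ E]
    (hf : IsSmoothImmersion I (fun x => (f x : R2n n))) (x : M) (t : PosReal) :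
    meanCurvature (I.prod 𝓘(ℝ, ℝ)) ⊤ (cone f) (x, t) =
      (t : ℝ)⁻¹ • meanCurvature I (ℝ ∙ (f x : R2n n))ᗮ (fun y => (f y : R2n n)) x := by
  have ht : (t : ℝ) ≠ 0 := ne_of_gt t.2
  set b := Module.finBasis ℝ E
  have hdet : IsUnit (firstFundamentalForm I b (fun y => (f y : R2n n)) x).det := by
    rw [isUnit_iff_ne_zero]
    refine (Matrix.det_gram_ne_zero_iff_linearIndependent (𝕜 := ℝ)).2 ?_
    exact b.linearIndependent.map' (fderiv ℝ _ _).toLinearMap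
      (LinearMap.ker_eq_bot.2 (hf.chartDeriv_injective x))
  have hinv : (firstFundamentalForm (I.prod 𝓘(ℝ, ℝ)) (b.prod (Module.Basis.singleton Unit ℝ))
      (cone f) (x, t))⁻¹ = Matrix.fromBlocks
        (((t : ℝ) ^ 2)⁻¹ • (firstFundamentalForm I b (fun y => (f y : R2n n)) x)⁻¹) 0 0 1 := by
    refine Matrix.inv_eq_right_inv ?_
    rw [firstFundamentalForm_cone hf.1, Matrix.fromBlocks_multiply]
    simp [Matrix.mul_nonsing_inv _ hdet, smul_smul, ht]
  rw [meanCurvature_eq_sum (b.prod (Module.Basis.singleton Unit ℝ)) ⊤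
    ((isSmoothImmersion_cone hf).chartDeriv_injective (x, t)), hinv]
  have hz : secondFundamentalForm I (ℝ ∙ (f x : R2n n))ᗮ (fun y => (f y : R2n n)) x 0 0 = 0 := by
    simp [secondFundamentalForm, chartDeriv₂]
  simp only [secondFundamentalForm_cone hf.1, Fintype.sum_sum_type]
  simp only [Matrix.fromBlocks_apply₁₁, Matrix.fromBlocks_apply₁₂, Matrix.fromBlocks_apply₂₁,
    Matrix.fromBlocks_apply₂₂, Matrix.zero_apply, zero_smul, Finset.sum_const_zero, add_zero,
    Module.Basis.prod_apply_inl_fst, Module.Basis.prod_apply_inr_fst, hz, smul_zero]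
  rw [meanCurvature_eq_sum b _ (hf.chartDeriv_injective x)]
  simp only [Finset.smul_sum, Matrix.smul_apply, smul_smul, smul_eq_mul]
  refine Finset.sum_congr rfl fun i _ => Finset.sum_congr rfl fun j _ => ?_
  congr 1
  field_simp

lemma isMinimal_cone_iff [FiniteDimensional ℝ E]
    (hf : IsSmoothImmersion I (fun x => (f x : R2n n))) :
    IsMinimal (I.prod 𝓘(ℝ, ℝ)) (cone f) ↔ IsMinimalInSphere I f := by
  constructor
  · intro h x
    have := h (x, ⟨1, Set.mem_Ioi.2 zero_lt_one⟩)
    rw [meanCurvature_cone hf] at this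
    simpa using this
  · rintro h ⟨x, t⟩
    rw [meanCurvature_cone hf, h x, smul_zero]

end ConeChart

/-! ### The Kähler form and the contact form -/

section Kahler

variable {n : ℕ}

lemma inner_J_left (u v : R2n n) : ⟪J u, v⟫_ℝ = -⟪u, J v⟫_ℝ := by
  simp [PiLp.inner_apply, J, Fintype.sum_sum_type, Finset.sum_neg_distrib]

lemma contactForm_eq_neg_kahlerForm (u v : R2n n) : contactForm u v = -kahlerForm u v :=
  inner_J_left u v

lemma kahlerForm_swap (u v : R2n n) : kahlerForm v u = -kahlerForm u v := by
  rw [← contactForm_eq_neg_kahlerForm u v]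
  exact real_inner_comm _ _

lemma kahlerForm_self (u : R2n n) : kahlerForm u u = 0 := by
  have := kahlerForm_swap u u
  linarith

lemma kahlerForm_add_left (u v w : R2n n) :
    kahlerForm (u + v) w = kahlerForm u w + kahlerForm v w := inner_add_left _ _ _

lemma kahlerForm_add_right (u v w : R2n n) :
    kahlerForm u (v + w) = kahlerForm u v + kahlerForm u w := by
  simp [kahlerForm, inner_add_right]

lemma kahlerForm_smul_left (a : ℝ) (u v : R2n n) : kahlerForm (a • u) v = a * kahlerForm u v :=
  real_inner_smul_left _ _ _

lemma kahlerForm_smul_right (a : ℝ) (u v : R2n n) :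
    kahlerForm u (a • v) = a * kahlerForm u v := by
  simp [kahlerForm, real_inner_smul_right]

variable {E : Type*} [NormedAddCommGroup E] [NormedSpace ℝ E]

/-- An integral submanifold of the contact distribution is isotropic. Differentiating
`⟪J u, ∂_w u⟫ = 0` in the direction `v` gives `⟪J u, ∂_v ∂_w u⟫ + ⟪J ∂_v u, ∂_w u⟫ = 0`; the first
term is symmetric in `v` and `w` and the second is antisymmetric, so both vanish. -/
lemma kahlerForm_fderiv_eq_zero {u : E → R2n n} {e : E} (hu : ContDiffAt ℝ ∞ u e)
    (h : ∀ᶠ y in 𝓝 e, ∀ w, contactForm (u y) (fderiv ℝ u y w) = 0) (v w : E) :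
    kahlerForm (fderiv ℝ u e v) (fderiv ℝ u e w) = 0 := by
  have hd : DifferentiableAt ℝ u e := hu.differentiableAt (by simp)
  have hdu : DifferentiableAt ℝ (fderiv ℝ u) e :=
    (hu.fderiv_right (m := ∞) (by simp)).differentiableAt (by simp)
  have hJ : HasFDerivAt (fun y => J (u y)) ((J (n := n)).toContinuousLinearMap.comp
      (fderiv ℝ u e)) e := (J (n := n)).toContinuousLinearMap.hasFDerivAt.comp e hd.hasFDerivAt
  have key : ∀ a b, ⟪J (u e), fderiv ℝ (fderiv ℝ u) e a b⟫_ℝ +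
      ⟪J (fderiv ℝ u e a), fderiv ℝ u e b⟫_ℝ = 0 := by
    intro a b
    have h0 : (fun y => ⟪J (u y), fderiv ℝ u y b⟫_ℝ) =ᶠ[𝓝 e] fun _ => (0 : ℝ) := by
      filter_upwards [h] with y hy using hy b
    have h1 := fderiv_inner_apply ℝ hJ.differentiableAt
      (hdu.clm_apply (differentiableAt_const b)) a
    rw [h0.fderiv_eq, hJ.fderiv, fderiv_clm_apply hdu (differentiableAt_const b)] at h1
    simpa using h1.symm
  have hsymm : fderiv ℝ (fderiv ℝ u) e v w = fderiv ℝ (fderiv ℝ u) e w v :=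
    (hu.isSymmSndFDerivAt (by
      rw [minSmoothness_of_isRCLikeNormedField]
      exact WithTop.coe_le_coe.2 (le_top : (2 : ℕ∞) ≤ ⊤))).eq v w
  have h1 := key v w
  have h2 := key w v
  rw [hsymm] at h1
  have h3 := contactForm_eq_neg_kahlerForm (fderiv ℝ u e v) (fderiv ℝ u e w)
  have h4 := contactForm_eq_neg_kahlerForm (fderiv ℝ u e w) (fderiv ℝ u e v)
  have h5 := kahlerForm_swap (fderiv ℝ u e v) (fderiv ℝ u e w)
  unfold contactForm at h3 h4
  linarith

end Kahler

/-! ### Lagrangian cones and Legendrian links -/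

section Lagrangian

variable {n : ℕ} {E : Type*} [NormedAddCommGroup E] [NormedSpace ℝ E]
  {H : Type*} [TopologicalSpace H] {I : ModelWithCorners ℝ E H} [I.Boundaryless]
  {M : Type*} [TopologicalSpace M] [ChartedSpace H M] [IsManifold I ∞ M]
  {f : M → Metric.sphere (0 : R2n n) 1}

lemma IsLegendrian.kahlerForm_eq_zero
    (hf : ContMDiff I 𝓘(ℝ, R2n n) ∞ (fun x => (f x : R2n n))) (h : IsLegendrian I f) (x : M)
    {v w : R2n n} (hv : v ∈ tangentPlane I (fun y => (f y : R2n n)) x)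
    (hw : w ∈ tangentPlane I (fun y => (f y : R2n n)) x) : kahlerForm v w = 0 := by
  have hfx : MDifferentiableAt I 𝓘(ℝ, R2n n) (fun x => (f x : R2n n)) x :=
    hf.mdifferentiableAt (by simp)
  obtain ⟨a, rfl⟩ := (mem_tangentPlane_iff hfx).1 hv
  obtain ⟨b, rfl⟩ := (mem_tangentPlane_iff hfx).1 hw
  refine kahlerForm_fderiv_eq_zero
    (contDiffAt_comp_extChartAt_symm hf x (mem_extChartAt_target (I := I) x)) ?_ a b
  -- At the nearby points the tangent plane has to be read off in the chart at `x`.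
  filter_upwards [extChartAt_target_mem_nhds (I := I) x] with e he c
  refine h.2 ((extChartAt I x).symm e) _ ?_
  rw [tangentPlane_eq_range_of_mem_source hf ((extChartAt I x).map_target he),
    (extChartAt I x).right_inv he]
  exact ⟨c, rfl⟩

omit [I.Boundaryless] [IsManifold I ∞ M] in
lemma finrank_tangentPlane {V : Type*} [NormedAddCommGroup V] [InnerProductSpace ℝ V] {F : M → V}
    (hF : IsSmoothImmersion I F) (x : M) :
    Module.finrank ℝ (tangentPlane I F x) = Module.finrank ℝ E :=
  LinearMap.finrank_range_of_inj (hF.2 x)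

lemma isLagrangian_cone_iff [FiniteDimensional ℝ E] (hn : 1 ≤ n)
    (hE : Module.finrank ℝ E = n - 1) (hf : IsSmoothImmersion I (fun x => (f x : R2n n))) :
    IsLagrangian (I.prod 𝓘(ℝ, ℝ)) (cone f) ↔ IsLegendrian I f := by
  constructor
  · intro h
    refine ⟨hE, fun x v hv => ?_⟩
    have hx := (h (x, ⟨1, Set.mem_Ioi.2 zero_lt_one⟩)).2
    rw [tangentPlane_cone hf.1] at hx
    rw [contactForm_eq_neg_kahlerForm, hx _ (Submodule.mem_sup_left
      (Submodule.mem_span_singleton_self _)) v (Submodule.mem_sup_right hv), neg_zero]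
  · rintro h ⟨x, t⟩
    constructor
    · rw [finrank_tangentPlane (isSmoothImmersion_cone hf), Module.finrank_prod, hE,
        Module.finrank_self]
      omega
    · rw [tangentPlane_cone hf.1]
      intro v hv w hw
      obtain ⟨_, ha, v, hv', rfl⟩ := Submodule.mem_sup.1 hv
      obtain ⟨a, rfl⟩ := Submodule.mem_span_singleton.1 ha
      obtain ⟨_, hb, w, hw', rfl⟩ := Submodule.mem_sup.1 hw
      obtain ⟨b, rfl⟩ := Submodule.mem_span_singleton.1 hb
      have h1 := h.kahlerForm_eq_zero hf.1 x hv' hw'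
      have h2 := h.2 x v hv'
      have h3 := h.2 x w hw'
      rw [contactForm_eq_neg_kahlerForm, neg_eq_zero] at h2 h3
      simp only [kahlerForm_add_left, kahlerForm_add_right, kahlerForm_smul_left,
        kahlerForm_smul_right, kahlerForm_self, h1, h3, kahlerForm_swap (f x : R2n n) v, h2]
      ring

end Lagrangian

/-! ### Smoothness of orthogonal projections onto varying subspaces -/

section Projection

variable {E V : Type*} [NormedAddCommGroup E] [InnerProductSpace ℝ E] [FiniteDimensional ℝ E]
  [NormedAddCommGroup V] [InnerProductSpace ℝ V] [FiniteDimensional ℝ V]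

open ContinuousLinearMap in
lemma isUnit_adjoint_comp_self_iff {D : E →L[ℝ] V} :
    IsUnit (adjoint D ∘L D) ↔ Function.Injective D := by
  rw [ContinuousLinearMap.isUnit_iff_bijective]
  constructor
  · intro h x y hxy
    exact h.1 (congrArg (adjoint D) hxy)
  · intro h
    have hinj : Function.Injective (adjoint D ∘L D) := by
      refine (injective_iff_map_eq_zero (adjoint D ∘L D)).2 fun x hx => ?_
      have h0 : ⟪D x, D x⟫_ℝ = 0 := by
        rw [← adjoint_inner_left]
        have hx' : adjoint D (D x) = 0 := hx
        rw [hx', inner_zero_left]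
      exact h ((inner_self_eq_zero.1 h0).trans (map_zero D).symm)
    exact ⟨hinj, LinearMap.injective_iff_surjective (f := (adjoint D ∘L D).toLinearMap).1 hinj⟩

open ContinuousLinearMap in
/-- The orthogonal projection onto the range of an injective `D` is `D (D* D)⁻¹ D*`. -/
lemma starProjection_range_eq {D : E →L[ℝ] V} (hD : Function.Injective D) :
    D.range.starProjection = D ∘L Ring.inverse (adjoint D ∘L D) ∘L adjoint D := by
  have hA := isUnit_adjoint_comp_self_iff.2 hD
  ext1 v
  refine Submodule.eq_starProjection_of_mem_of_inner_eq_zero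
    (show D (Ring.inverse (adjoint D ∘L D) (adjoint D v)) ∈ D.range from ⟨_, rfl⟩) ?_
  rintro _ ⟨w, rfl⟩
  have h : adjoint D (D (Ring.inverse (adjoint D ∘L D) (adjoint D v))) = adjoint D v :=
    DFunLike.congr_fun (Ring.mul_inverse_cancel _ hA) (adjoint D v)
  change ⟪v - D (Ring.inverse (adjoint D ∘L D) (adjoint D v)), D w⟫_ℝ = 0
  rw [← adjoint_inner_left, map_sub, h, sub_self, inner_zero_left]

/-- Over `ℝ` the adjoint, which Mathlib bundles as a conjugate-linear map, is linear, hence smooth. -/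
lemma contDiff_adjoint :
    ContDiff ℝ ∞ (fun D : E →L[ℝ] V => ContinuousLinearMap.adjoint D) := by
  let A : (E →L[ℝ] V) →ₗ[ℝ] (V →L[ℝ] E) :=
    { toFun := fun D => ContinuousLinearMap.adjoint D
      map_add' := fun D D' => map_add _ D D'
      map_smul' := fun c D => by simp }
  exact A.toContinuousLinearMap.contDiff

lemma contDiffAt_starProjection_range {X : Type*} [NormedAddCommGroup X] [NormedSpace ℝ X]
    {D : X → E →L[ℝ] V} {e : X} (hD : ContDiffAt ℝ ∞ D e) (hinj : Function.Injective (D e)) :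
    ContDiffAt ℝ ∞ (fun y => (D y).range.starProjection) e := by
  have hadj : ContDiffAt ℝ ∞ (fun y => ContinuousLinearMap.adjoint (D y)) e :=
    contDiff_adjoint.contDiffAt.comp e hD
  have hA : ContDiffAt ℝ ∞ (fun y => ContinuousLinearMap.adjoint (D y) ∘L D y) e :=
    hadj.clm_comp hD
  obtain ⟨a, ha⟩ := isUnit_adjoint_comp_self_iff.2 hinj
  have hinv : ContDiffAt ℝ ∞
      (fun y => Ring.inverse (ContinuousLinearMap.adjoint (D y) ∘L D y)) e := by
    refine ContDiffAt.comp (g := Ring.inverse) e ?_ hA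
    rw [← ha]
    exact contDiffAt_ringInverse ℝ a
  have hopen : ∀ᶠ y in 𝓝 e, IsUnit (ContinuousLinearMap.adjoint (D y) ∘L D y) :=
    hA.continuousAt.eventually
      (Units.isOpen.mem_nhds (isUnit_adjoint_comp_self_iff.2 hinj))
  refine (hD.clm_comp (hinv.clm_comp hadj)).congr_of_eventuallyEq ?_
  filter_upwards [hopen] with y hy
  exact starProjection_range_eq (isUnit_adjoint_comp_self_iff.1 hy)

omit [FiniteDimensional ℝ V] in
lemma starProjection_span_singleton_sup {p : V} (hp : ‖p‖ = 1) (T : Submodule ℝ V)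
    [T.HasOrthogonalProjection] [((ℝ ∙ p) ⊔ T).HasOrthogonalProjection]
    (hT : ∀ v ∈ T, ⟪p, v⟫_ℝ = 0) :
    ((ℝ ∙ p) ⊔ T).starProjection = (innerSL ℝ p).smulRight p + T.starProjection := by
  ext1 v
  refine Submodule.eq_starProjection_of_mem_of_inner_eq_zero (Submodule.add_mem_sup
    (Submodule.smul_mem _ _ (Submodule.mem_span_singleton_self p))
    (Submodule.starProjection_apply_mem T v)) ?_
  intro w hw
  obtain ⟨_, hq, w, hw', rfl⟩ := Submodule.mem_sup.1 hw
  obtain ⟨a, rfl⟩ := Submodule.mem_span_singleton.1 hq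
  have h1 : ⟪T.starProjection v, p⟫_ℝ = 0 := by
    rw [real_inner_comm]; exact hT _ (Submodule.starProjection_apply_mem T v)
  have h2 := T.starProjection_inner_eq_zero v w hw'
  rw [inner_sub_left] at h2
  simp only [add_apply, ContinuousLinearMap.smulRight_apply, innerSL_apply_apply, inner_sub_left,
    inner_add_left, inner_add_right, real_inner_smul_left, real_inner_smul_right, h1, hT w hw',
    real_inner_self_eq_norm_sq, hp, real_inner_comm v p]
  linarith

lemma contDiffAt_starProjection_span_sup_range {u : E → V} {e : E} (hu : ContDiffAt ℝ ∞ u e)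
    (h1 : ∀ y, ‖u y‖ = 1) (hinj : Function.Injective (fderiv ℝ u e)) :
    ContDiffAt ℝ ∞ (fun y => ((ℝ ∙ u y) ⊔ (fderiv ℝ u y).range).starProjection) e := by
  have hdu : ContDiffAt ℝ ∞ (fderiv ℝ u) e := hu.fderiv_right (by simp)
  have hs : ContDiffAt ℝ ∞ (fun y => (innerSL ℝ (u y)).smulRight (u y)) e :=
    ((innerSL ℝ (E := V)).contDiff.contDiffAt.comp e hu).smulRight hu
  refine (hs.add (contDiffAt_starProjection_range hdu hinj)).congr_of_eventuallyEq ?_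
  have : ∀ᶠ y in 𝓝 e, ContDiffAt ℝ 1 u y :=
    (hu.of_le (by exact_mod_cast le_top)).eventually (by simp)
  filter_upwards [this] with y hy
  refine starProjection_span_singleton_sup (h1 y) _ ?_
  rintro _ ⟨w, rfl⟩
  exact inner_fderiv_eq_zero_of_norm_eq_one (hy.differentiableAt (by simp)) h1 w

end Projection

/-! ### The Gauss map of the cone -/

section GaussMap

variable {n : ℕ} {E : Type*} [NormedAddCommGroup E] [InnerProductSpace ℝ E]
  [FiniteDimensional ℝ E]
  {H : Type*} [TopologicalSpace H] {I : ModelWithCorners ℝ E H} [I.Boundaryless]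
  {M : Type*} [TopologicalSpace M] [ChartedSpace H M] [IsManifold I ∞ M]
  {f : M → Metric.sphere (0 : R2n n) 1}

/-- The tangent plane of the cone along the ray through `f x` depends smoothly on `x`. Here it is
written `ℝ f(x) ⊕ T_x M`, so that it is visibly a function on `M` alone. -/
lemma contMDiff_starProjection_span_sup_tangentPlane
    (hf : IsSmoothImmersion I (fun x => (f x : R2n n))) :
    ContMDiff I 𝓘(ℝ, R2n n →L[ℝ] R2n n) ∞ fun x =>
      ((ℝ ∙ (f x : R2n n)) ⊔ tangentPlane I (fun y => (f y : R2n n)) x).starProjection := by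
  intro x
  have hu := contDiffAt_comp_extChartAt_symm hf.1 x (mem_extChartAt_target (I := I) x)
  have hP := contDiffAt_starProjection_span_sup_range hu (fun e => by simp)
    (hf.chartDeriv_injective x)
  refine (hP.contMDiffAt.comp x contMDiffAt_extChartAt).congr_of_eventuallyEq ?_
  filter_upwards [extChartAt_source_mem_nhds (I := I) x] with y hy
  simp only [Function.comp_apply, (extChartAt I x).left_inv hy,
    tangentPlane_eq_range_of_mem_source hf.1 hy]

omit [FiniteDimensional ℝ E] in
/-- The Gauss map of the cone is constant along rays: it factors through the projection to `M`. -/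
lemma toProjection_gaussMap_cone (hf : IsSmoothImmersion I (fun x => (f x : R2n n)))
    (hL : IsLagrangian (I.prod 𝓘(ℝ, ℝ)) (cone f)) :
    (fun q => (gaussMap (I.prod 𝓘(ℝ, ℝ)) hL q).toProjection) =
      (fun x => ((ℝ ∙ (f x : R2n n)) ⊔
        tangentPlane I (fun y => (f y : R2n n)) x).starProjection) ∘ Prod.fst := by
  funext ⟨x, t⟩
  simp only [LagrangianGrassmannian.toProjection, gaussMap, tangentPlane_cone hf.1,
    Function.comp_apply]

lemma smoothIntoLG_gaussMap_cone (hf : IsSmoothImmersion I (fun x => (f x : R2n n)))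
    (hL : IsLagrangian (I.prod 𝓘(ℝ, ℝ)) (cone f)) :
    SmoothIntoLG (I.prod 𝓘(ℝ, ℝ)) (gaussMap (I.prod 𝓘(ℝ, ℝ)) hL) := by
  unfold SmoothIntoLG
  rw [toProjection_gaussMap_cone hf hL]
  exact (contMDiff_starProjection_span_sup_tangentPlane hf).comp contMDiff_fst

lemma rankIntoLG_gaussMap_cone_le (hf : IsSmoothImmersion I (fun x => (f x : R2n n)))
    (hL : IsLagrangian (I.prod 𝓘(ℝ, ℝ)) (cone f)) (q : M × PosReal) :
    rankIntoLG (I.prod 𝓘(ℝ, ℝ)) (gaussMap (I.prod 𝓘(ℝ, ℝ)) hL) q ≤ Module.finrank ℝ E := by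
  unfold rankIntoLG
  rw [toProjection_gaussMap_cone hf hL]
  have hcomp := mfderiv_comp q
    ((contMDiff_starProjection_span_sup_tangentPlane hf).mdifferentiableAt (x := q.1) (by simp))
    (mdifferentiableAt_fst (I := I) (I' := 𝓘(ℝ, ℝ)) (x := q))
  rw [hcomp]
  have hle : ∀ (A : E →L[ℝ] R2n n →L[ℝ] R2n n) (B : E × ℝ →L[ℝ] E),
      Module.finrank ℝ (A ∘L B).range ≤ Module.finrank ℝ E := fun A B =>
    (Submodule.finrank_mono (LinearMap.range_comp_le_range B.toLinearMap A.toLinearMap)).trans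
      (LinearMap.finrank_range_le A.toLinearMap)
  exact hle _ (mfderiv (I.prod 𝓘(ℝ, ℝ)) I Prod.fst q)

end GaussMap

end LegendrianCone

open LegendrianCone in
theorem proposition4p2 (n : ℕ) (hn : 1 ≤ n)
    {M : Type*} [TopologicalSpace M] [ChartedSpace (EuclideanSpace ℝ (Fin (n - 1))) M]
    [IsManifold (𝓡 (n - 1)) ∞ M]
    (f : M → Metric.sphere (0 : R2n n) 1)
    (hf : IsSmoothImmersion (𝓡 (n - 1)) (fun x => (f x : R2n n))) :
    (IsMinimalInSphere (𝓡 (n - 1)) f ∧ IsLegendrian (𝓡 (n - 1)) f ↔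
      IsMinimalLagrangianSubmanifold ((𝓡 (n - 1)).prod 𝓘(ℝ, ℝ)) (cone f)) ∧
    ∀ hL : IsLagrangian ((𝓡 (n - 1)).prod 𝓘(ℝ, ℝ)) (cone f),
      SmoothIntoLG ((𝓡 (n - 1)).prod 𝓘(ℝ, ℝ))
          (gaussMap ((𝓡 (n - 1)).prod 𝓘(ℝ, ℝ)) hL) ∧
        ∀ q : M × PosReal,
          rankIntoLG ((𝓡 (n - 1)).prod 𝓘(ℝ, ℝ))
            (gaussMap ((𝓡 (n - 1)).prod 𝓘(ℝ, ℝ)) hL) q ≤ n - 1 := by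
  have hE : Module.finrank ℝ (EuclideanSpace ℝ (Fin (n - 1))) = n - 1 := finrank_euclideanSpace_fin
  refine ⟨?_, fun hL => ⟨smoothIntoLG_gaussMap_cone hf hL, fun q => ?_⟩⟩
  · rw [IsMinimalLagrangianSubmanifold, isMinimal_cone_iff hf, isLagrangian_cone_iff hn hE hf]
    exact (and_iff_right (isSmoothImmersion_cone hf)).symm
  · exact (rankIntoLG_gaussMap_cone_le hf hL q).trans_eq hE
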